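/- Let $\omega:[0,\infty)\to[0,\infty)$ be a weight function: continuous, nondecreasing, $\omega(0)=0$, $\omega(s+t)\le\omega(s)+\omega(t)$, $\int_1^\infty \omega(t)t^{-2}\,dt<\infty$ and $\omega(t)/\log(1+t)\to\infty$ as $t\to\infty$. Let $\Omega\subseteq\mathbb R^d$ be open. For $l>0$ put $\|f\|_l=\int_{\mathbb R^d}|\hat f(\xi)|\,e^{l\omega(|\xi|)}\,d\xi$, where $\hat f(\xi)=\int f(x)e^{-2\pi i x\cdot\xi}dx$. Let $\mathcal D^{(\omega)}(\Omega)$ be the space of smooth $\varphi:\mathbb R^d\to\mathbb C$ with compact support in $\Omega$ and $\|\varphi\|_l<\infty$ for all $l>0$; for compact $K\subseteq\Omega$ let $\mathcal D^{(\omega)}_K$ be its subspace of functions supported in $K$. Let $\mathcal D'^{(\omega)}(\Omega)$ be the space of linear functionals $T$ on $\mathcal D^{(\omega)}(\Omega)$ such that for every compact $K\subseteq\Omega$ there are $C,l>0$ with $|\langle T,\varphi\rangle|\le C\|\varphi\|_l$ for all $\varphi\in\mathcal D^{(\omega)}_K$ (Beurling $(\omega)$-ultradistributions). Let $\mathcal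 E^{(\omega)}(\Omega)$ be the space of smooth $f:\Omega\to\mathbb C$ with $\varphi f\in\mathcal D^{(\omega)}(\Omega)$ for all $\varphi\in\mathcal D^{(\omega)}(\Omega)$, and for compact $K\subseteq\Omega$ put $\|f\|_{K,l}=\inf\{\|\chi f\|_l:\chi\in\mathcal D^{(\omega)}(\Omega),\ \chi=1\text{ on }K\}$. A net $(g_\varepsilon)_{0<\varepsilon<1}$ in $\mathcal E^{(\omega)}(\Omega)$ is moderate if for every compact $K\subseteq\Omega$ and every $h>0$ there is $k>0$ with $\|g_\varepsilon\|_{K,h}=o(e^{k\omega(1/\varepsilon)})$ as $\varepsilon\to0$; negligible if $\|g_\varepsilon\|_{K,h}=o(e^{-k\omega(1/\varepsilon)})$ for all compact $K\subseteq\Omega$ and all $h,k>0$; regular if it is moderate and for every compact $K\subseteq\Omega$ there is $k>0$ such that $\|g_\varepsilon\|_{K,h}=o(e^{k\omega(1/\varepsilon)})$ for all $h>0$. Let $\mathcal G^{(\omega)}(\Omega)$ be the quotient of the moderate nets by the negligible nets, and $\mathcal G^{(\omega),\infty}(\Omega)$ the set of classes that have a regular representative. An ultradistribution $T\in\mathcal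 D'^{(\omega)}(\Omega)$ is strongly associated to $g\in\mathcal G^{(\omega)}(\Omega)$ if, for a representative $(g_\varepsilon)$ of $g$, for every compact $K\subseteq\Omega$ there is $b>0$ such that for all $\varphi\in\mathcal D^{(\omega)}_K$ $$\int_\Omega g_\varepsilon\varphi\,dx-\langle T,\varphi\rangle=o\big(e^{-b\omega(1/\varepsilon)}\big)\qquad(\varepsilon\to0).$$ **Theorem.** If $T\in\mathcal D'^{(\omega)}(\Omega)$ is strongly associated to some $g\in\mathcal G^{(\omega),\infty}(\Omega)$, then $T\in\mathcal E^{(\omega)}(\Omega)$, i.e. there is $f\in\mathcal E^{(\omega)}(\Omega)$ with $\langle T,\varphi\rangle=\int_\Omega f\varphi\,dx$ for all $\varphi\in\mathcal D^{(\omega)}(\Omega)$. -/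

import Mathlib

open MeasureTheory Filter Topology
open scoped ENNReal FourierTransform

noncomputable section

namespace BeurlingBjorck

/-- Weight functions: continuous nondecreasing nonnegative functions on `[0, ∞)` that vanish at `0`,
are subadditive, non-quasianalytic, and dominate `log (1 + t)` strictly. Only the values at
nonnegative arguments matter. -/
structure WeightFunction where
  /-- the underlying function -/
  toFun : ℝ → ℝ
  continuousOn' : ContinuousOn toFun (Set.Ici 0)
  monotoneOn' : MonotoneOn toFun (Set.Ici 0)
  nonneg' : ∀ t, 0 ≤ t → 0 ≤ toFun t
  map_zero' : toFun 0 = 0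
  subadd' : ∀ s t, 0 ≤ s → 0 ≤ t → toFun (s + t) ≤ toFun s + toFun t
  integrable' : IntegrableOn (fun t => toFun t / t ^ 2) (Set.Ioi 1)
  log_littleO' : Tendsto (fun t => toFun t / Real.log (1 + t)) atTop atTop

instance : CoeFun WeightFunction fun _ => ℝ → ℝ := ⟨WeightFunction.toFun⟩

/-- The space `ℝ^d` with its Euclidean norm. -/
abbrev Space (d : ℕ) : Type := EuclideanSpace ℝ (Fin d)

variable {d : ℕ}

/-- The norm `‖f‖_l^ω = ∫ |f̂(ξ)| exp (l ω(|ξ|)) dξ`, with values in `[0, ∞]`. The Fourier transform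
is `f̂(ξ) = ∫ f(x) exp (-2πi x·ξ) dx`; since `ω` is nondecreasing and subadditive, another
normalisation gives the same families of norms up to equivalence. -/
def fourierNorm (ω : WeightFunction) (l : ℝ) (f : Space d → ℂ) : ℝ≥0∞ :=
  ∫⁻ ξ, ‖𝓕 f ξ‖ₑ * ENNReal.ofReal (Real.exp (l * ω ‖ξ‖))

theorem measurable_weight (ω : WeightFunction) (l : ℝ) :
    Measurable fun ξ : Space d => ENNReal.ofReal (Real.exp (l * ω ‖ξ‖)) := by
  have h : Continuous fun ξ : Space d => ω ‖ξ‖ :=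
    ω.continuousOn'.comp_continuous continuous_norm (fun ξ => norm_nonneg ξ)
  exact (ENNReal.continuous_ofReal.comp
    (Real.continuous_exp.comp (continuous_const.mul h))).measurable

theorem fourierNorm_zero (ω : WeightFunction) (l : ℝ) :
    fourierNorm ω l (0 : Space d → ℂ) = 0 := by
  have h : 𝓕 (0 : Space d → ℂ) = 0 := by
    ext ξ
    simp [Real.fourier_eq]
  simp [fourierNorm, h]

theorem fourierNorm_add_le (ω : WeightFunction) (l : ℝ) {f g : Space d → ℂ}
    (hf : Integrable f) (hg : Integrable g) :
    fourierNorm ω l (f + g) ≤ fourierNorm ω l f + fourierNorm ω l g := by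
  have hadd : ∀ ξ, 𝓕 (f + g) ξ = 𝓕 f ξ + 𝓕 g ξ := by
    intro ξ
    simp only [Real.fourier_eq, Pi.add_apply, smul_add]
    exact integral_add ((Real.fourierIntegral_convergent_iff ξ).2 hf)
      ((Real.fourierIntegral_convergent_iff ξ).2 hg)
  have hcont : Continuous (𝓕 f) :=
    VectorFourier.fourierIntegral_continuous Real.continuous_fourierChar
      (by exact continuous_inner) hf
  unfold fourierNorm
  have hm : Measurable fun ξ => ‖𝓕 f ξ‖ₑ * ENNReal.ofReal (Real.exp (l * ω ‖ξ‖)) :=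
    hcont.enorm.measurable.mul (measurable_weight ω l)
  rw [← lintegral_add_left hm]
  refine lintegral_mono fun ξ => ?_
  rw [hadd, ← add_mul]
  gcongr
  exact enorm_add_le _ _

theorem fourierNorm_smul (ω : WeightFunction) (l : ℝ) (c : ℂ) (f : Space d → ℂ) :
    fourierNorm ω l (c • f) = ‖c‖ₑ * fourierNorm ω l f := by
  have h : ∀ ξ, 𝓕 (c • f) ξ = c * 𝓕 f ξ := by
    intro ξ
    simp only [Real.fourier_eq, Pi.smul_apply]
    rw [← smul_eq_mul, ← integral_smul]
    exact integral_congr_ae (Eventually.of_forall fun v => smul_comm _ c (f v))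
  unfold fourierNorm
  rw [← lintegral_const_mul' _ _ enorm_ne_top]
  simp only [h, enorm_mul, mul_assoc]

theorem fourierNorm_mul_le (ω : WeightFunction) {l : ℝ} (hl : 0 ≤ l) {f g : Space d → ℂ}
    (hf : ContDiff ℝ ((⊤ : ℕ∞) : WithTop ℕ∞) f) (hf' : HasCompactSupport f)
    (hg : ContDiff ℝ ((⊤ : ℕ∞) : WithTop ℕ∞) g) (hg' : HasCompactSupport g) :
    fourierNorm ω l (f * g) ≤ fourierNorm ω l f * fourierNorm ω l g := by
  let F : SchwartzMap (Space d) ℂ := hf'.toSchwartzMap hf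
  let G : SchwartzMap (Space d) ℂ := hg'.toSchwartzMap hg
  have hFc : Continuous (𝓕 f) :=
    VectorFourier.fourierIntegral_continuous Real.continuous_fourierChar
      (by exact continuous_inner) (hf.continuous.integrable_of_hasCompactSupport hf')
  have hGc : Continuous (𝓕 g) :=
    VectorFourier.fourierIntegral_continuous Real.continuous_fourierChar
      (by exact continuous_inner) (hg.continuous.integrable_of_hasCompactSupport hg')
  have hconv : ∀ ξ, 𝓕 (f * g) ξ = ∫ t, 𝓕 f (-t) * 𝓕 g (ξ + t) := by
    intro ξ
    have h1 := SchwartzMap.convolution_apply (ContinuousLinearMap.mul ℂ ℂ)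
      (𝓕⁻ F) (𝓕⁻ G) (-ξ)
    have h2 : SchwartzMap.convolution (ContinuousLinearMap.mul ℂ ℂ) (𝓕⁻ F) (𝓕⁻ G) (-ξ)
        = 𝓕 (f * g) ξ := by
      have h3 : SchwartzMap.convolution (ContinuousLinearMap.mul ℂ ℂ) (𝓕⁻ F) (𝓕⁻ G)
          = 𝓕⁻ (SchwartzMap.pairing (ContinuousLinearMap.mul ℂ ℂ) F G) := by
        have h4 := SchwartzMap.fourier_convolution (ContinuousLinearMap.mul ℂ ℂ) (𝓕⁻ F) (𝓕⁻ G)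
        have h5 := congrArg (fun H : SchwartzMap (Space d) ℂ => 𝓕⁻ H) h4
        simpa using h5
      rw [h3, SchwartzMap.fourierInv_coe, Real.fourierInv_eq_fourier_neg, neg_neg]
      rfl
    rw [← h2, h1, convolution_def]
    refine integral_congr_ae (Eventually.of_forall fun t => ?_)
    have e1 : (𝓕⁻ F) t = 𝓕 f (-t) := by
      rw [SchwartzMap.fourierInv_coe, Real.fourierInv_eq_fourier_neg]
      rfl
    have e2 : (𝓕⁻ G) (-ξ - t) = 𝓕 g (ξ + t) := by
      rw [SchwartzMap.fourierInv_coe, Real.fourierInv_eq_fourier_neg]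
      have : -(-ξ - t) = ξ + t := by abel
      rw [this]
      rfl
    simp [e1, e2]
  let w : Space d → ℝ≥0∞ := fun ξ => ENNReal.ofReal (Real.exp (l * ω ‖ξ‖))
  have hw : Measurable w := measurable_weight ω l
  have hsub : ∀ ξ t : Space d, w ξ ≤ w (-t) * w (ξ + t) := by
    intro ξ t
    simp only [w]
    rw [← ENNReal.ofReal_mul (Real.exp_pos _).le, ← Real.exp_add, ← mul_add]
    refine ENNReal.ofReal_le_ofReal (Real.exp_le_exp.2 (mul_le_mul_of_nonneg_left ?_ hl))
    have h0 : ‖ξ‖ ≤ ‖-t‖ + ‖ξ + t‖ := by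
      have := norm_add_le (-t) (ξ + t)
      simpa using this
    exact (ω.monotoneOn' (norm_nonneg ξ) (add_nonneg (norm_nonneg _) (norm_nonneg _)) h0).trans
      (ω.subadd' _ _ (norm_nonneg _) (norm_nonneg _))
  let A : Space d → ℝ≥0∞ := fun ξ => ‖𝓕 f ξ‖ₑ * w ξ
  let B : Space d → ℝ≥0∞ := fun ξ => ‖𝓕 g ξ‖ₑ * w ξ
  have hA : Measurable A := hFc.enorm.measurable.mul hw
  have hB : Measurable B := hGc.enorm.measurable.mul hw
  calc fourierNorm ω l (f * g)
      ≤ ∫⁻ ξ, ∫⁻ t, A (-t) * B (ξ + t) := by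
        refine lintegral_mono fun ξ => ?_
        rw [hconv]
        calc ‖∫ t, 𝓕 f (-t) * 𝓕 g (ξ + t)‖ₑ * w ξ
            ≤ (∫⁻ t, ‖𝓕 f (-t) * 𝓕 g (ξ + t)‖ₑ) * w ξ := by
              gcongr
              exact enorm_integral_le_lintegral_enorm _
          _ = ∫⁻ t, ‖𝓕 f (-t) * 𝓕 g (ξ + t)‖ₑ * w ξ :=
              (lintegral_mul_const' _ _ ENNReal.ofReal_ne_top).symm
          _ ≤ ∫⁻ t, A (-t) * B (ξ + t) := by
              refine lintegral_mono fun t => ?_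
              simp only [A, B]
              rw [enorm_mul, mul_mul_mul_comm]
              gcongr
              exact hsub ξ t
    _ = ∫⁻ t, ∫⁻ ξ, A (-t) * B (ξ + t) :=
        lintegral_lintegral_swap (by
          refine Measurable.aemeasurable ?_
          exact (hA.comp measurable_snd.neg).mul
            (hB.comp (measurable_fst.add measurable_snd)))
    _ = ∫⁻ t, A (-t) * ∫⁻ ξ, B ξ := by
        refine lintegral_congr fun t => ?_
        have hBt : Measurable fun ξ => B (ξ + t) := hB.comp (measurable_id.add_const t)
        rw [lintegral_const_mul _ hBt, lintegral_add_right_eq_self]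
    _ = fourierNorm ω l f * fourierNorm ω l g := by
        have hAn : Measurable fun t => A (-t) := hA.comp measurable_neg
        rw [lintegral_mul_const _ hAn, lintegral_neg_eq_self]
        rfl

/-- `𝒟^{(ω)}(Ω)`: smooth functions with compact support in `Ω` all of whose norms `‖·‖_l^ω`, `l > 0`,
are finite. -/
def testFunctions (ω : WeightFunction) (Ω : TopologicalSpace.Opens (Space d)) :
    Submodule ℂ (Space d → ℂ) where
  carrier := {φ | ContDiff ℝ ((⊤ : ℕ∞) : WithTop ℕ∞) φ ∧ HasCompactSupport φ ∧ tsupport φ ⊆ Ω ∧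
    ∀ l : ℝ, 0 < l → fourierNorm ω l φ < ∞}
  add_mem' := by
    rintro f g ⟨hf, hf', hf'', hfl⟩ ⟨hg, hg', hg'', hgl⟩
    refine ⟨hf.add hg, hf'.add hg', (tsupport_add f g).trans (Set.union_subset hf'' hg''),
      fun l hl => ?_⟩
    exact (fourierNorm_add_le ω l (hf.continuous.integrable_of_hasCompactSupport hf')
      (hg.continuous.integrable_of_hasCompactSupport hg')).trans_lt
      (ENNReal.add_lt_top.2 ⟨hfl l hl, hgl l hl⟩)
  zero_mem' := by
    refine ⟨contDiff_const, HasCompactSupport.zero, by simp [tsupport], fun l _ => ?_⟩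
    rw [fourierNorm_zero]
    exact ENNReal.zero_lt_top
  smul_mem' := by
    rintro c f ⟨hf, hf', hf'', hfl⟩
    refine ⟨hf.const_smul c, hf'.smul_left (f := fun _ => c),
      (tsupport_smul_subset_right (fun _ => c) f).trans hf'', fun l hl => ?_⟩
    rw [fourierNorm_smul]
    exact ENNReal.mul_lt_top enorm_lt_top (hfl l hl)

/-- `ℰ^{(ω)}(Ω)`: functions smooth on `Ω` whose product with every element of `𝒟^{(ω)}(Ω)` belongs to
`𝒟^{(ω)}(Ω)`. Functions on `Ω` are given by total functions whose values off `Ω` are irrelevant. -/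
def ultradiffFunctions (ω : WeightFunction) (Ω : TopologicalSpace.Opens (Space d)) :
    Submodule ℂ (Space d → ℂ) where
  carrier := {f | ContDiffOn ℝ ((⊤ : ℕ∞) : WithTop ℕ∞) f Ω ∧ ∀ φ ∈ testFunctions ω Ω, φ * f ∈ testFunctions ω Ω}
  add_mem' := by
    rintro f g ⟨hf, hf'⟩ ⟨hg, hg'⟩
    refine ⟨hf.add hg, fun φ hφ => ?_⟩
    rw [mul_add]
    exact add_mem (hf' φ hφ) (hg' φ hφ)
  zero_mem' := ⟨contDiffOn_const, fun φ _ => by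
    rw [mul_zero]
    exact zero_mem _⟩
  smul_mem' := by
    rintro c f ⟨hf, hf'⟩
    refine ⟨hf.const_smul c, fun φ hφ => ?_⟩
    rw [mul_smul_comm]
    exact Submodule.smul_mem _ c (hf' φ hφ)

/-- `𝒟'^{(ω)}(Ω)`: linear functionals on `𝒟^{(ω)}(Ω)` that are continuous for the inductive limit
topology, i.e. whose restriction to the Fréchet space of test functions supported in `K` is
continuous for the norms `‖·‖_l^ω`, `l > 0`, for every compact `K ⊆ Ω`. -/
structure Ultradistribution (ω : WeightFunction) (Ω : TopologicalSpace.Opens (Space d)) where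
  /-- the underlying linear functional -/
  toLinearMap : testFunctions ω Ω →ₗ[ℂ] ℂ
  continuous' : ∀ K : Set (Space d), IsCompact K → K ⊆ Ω →
    ∃ C l : ℝ, 0 < C ∧ 0 < l ∧ ∀ φ : testFunctions ω Ω, tsupport (φ : Space d → ℂ) ⊆ K →
      ‖toLinearMap φ‖ ≤ C * (fourierNorm ω l (φ : Space d → ℂ)).toReal

/-- The ultradistribution `T` is (given by integration against) an element of `ℰ^{(ω)}(Ω)`. -/
def Ultradistribution.IsUltradifferentiable {ω : WeightFunction}
    {Ω : TopologicalSpace.Opens (Space d)} (T : Ultradistribution ω Ω) : Prop :=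
  ∃ f ∈ ultradiffFunctions ω Ω, ∀ φ : testFunctions ω Ω,
    T.toLinearMap φ = ∫ x, f x * (φ : Space d → ℂ) x

/-- `‖f‖_{K,l}^ω`: the infimum of `‖χ f‖_l^ω` over the `χ ∈ 𝒟^{(ω)}(Ω)` equal to `1` on `K`. -/
def localNorm (ω : WeightFunction) (Ω : TopologicalSpace.Opens (Space d)) (K : Set (Space d))
    (l : ℝ) (f : Space d → ℂ) : ℝ≥0∞ :=
  ⨅ (χ : testFunctions ω Ω) (_ : ∀ x ∈ K, (χ : Space d → ℂ) x = 1),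
    fourierNorm ω l ((χ : Space d → ℂ) * f)

/-- The filter `ε → 0` on the parameter interval `(0, 1)`. -/
def epsFilter : Filter (Set.Ioo (0 : ℝ) 1) := comap (fun ε => (ε : ℝ)) (𝓝 0)

instance : NeBot epsFilter := by
  refine comap_neBot_iff.2 fun s hs => ?_
  obtain ⟨r, hr, hrs⟩ := Metric.mem_nhds_iff.1 hs
  refine ⟨⟨min (r / 2) (1 / 2), by positivity, by
    exact (min_le_right _ _).trans_lt (by norm_num)⟩, hrs ?_⟩
  rw [Metric.mem_ball, Real.dist_eq, sub_zero, abs_of_pos (by positivity)]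
  exact (min_le_left _ _).trans_lt (by linarith)

/-- Nets `(g_ε)`, `0 < ε < 1`, in `ℰ^{(ω)}(Ω)`. -/
abbrev Net (ω : WeightFunction) (Ω : TopologicalSpace.Opens (Space d)) : Type :=
  Set.Ioo (0 : ℝ) 1 → ultradiffFunctions ω Ω

/-- `‖g_ε‖_{K,h}^ω = o(exp (k ω(1/ε)))` as `ε → 0`; the exponent `k` may have any sign. -/
def NormLittleO {ω : WeightFunction} {Ω : TopologicalSpace.Opens (Space d)}
    (g : Net ω Ω) (K : Set (Space d)) (h k : ℝ) : Prop :=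
  Tendsto (fun ε => localNorm ω Ω K h (g ε : Space d → ℂ) /
    ENNReal.ofReal (Real.exp (k * ω (1 / (ε : ℝ))))) epsFilter (𝓝 0)

/-- Moderate nets, `ℰ_M^{(ω)}(Ω)`. -/
def IsModerate {ω : WeightFunction} {Ω : TopologicalSpace.Opens (Space d)} (g : Net ω Ω) : Prop :=
  ∀ K : Set (Space d), IsCompact K → K ⊆ Ω → ∀ h : ℝ, 0 < h → ∃ k : ℝ, 0 < k ∧ NormLittleO g K h k

/-- Negligible nets, `𝒩^{(ω)}(Ω)`. -/
def IsNegligible {ω : WeightFunction} {Ω : TopologicalSpace.Opens (Space d)} (g : Net ω Ω) : Prop :=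
  ∀ K : Set (Space d), IsCompact K → K ⊆ Ω → ∀ h : ℝ, 0 < h → ∀ k : ℝ, 0 < k → NormLittleO g K h (-k)

/-- Regular nets, `ℰ^{(ω),∞}(Ω)`: moderate nets for which the exponent `k` does not depend on `h`. -/
def IsRegularNet {ω : WeightFunction} {Ω : TopologicalSpace.Opens (Space d)} (g : Net ω Ω) : Prop :=
  IsModerate g ∧ ∀ K : Set (Space d), IsCompact K → K ⊆ Ω →
    ∃ k : ℝ, 0 < k ∧ ∀ h : ℝ, 0 < h → NormLittleO g K h k

theorem IsModerate.exists_cutoff {ω : WeightFunction} {Ω : TopologicalSpace.Opens (Space d)}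
    {g : Net ω Ω} (hg : IsModerate g) {K : Set (Space d)} (hK : IsCompact K) (hKΩ : K ⊆ Ω) :
    ∃ χ : testFunctions ω Ω, ∀ x ∈ K, (χ : Space d → ℂ) x = 1 := by
  by_contra! hno
  obtain ⟨k, -, hk⟩ := hg K hK hKΩ 1 one_pos
  have htop : ∀ f : Space d → ℂ, localNorm ω Ω K 1 f = ∞ := by
    intro f
    refine iInf₂_eq_top.2 fun χ hχ => ?_
    obtain ⟨x, hx, hx'⟩ := hno χ
    exact absurd (hχ x hx) hx'
  unfold NormLittleO at hk
  simp only [htop, ENNReal.top_div_of_ne_top ENNReal.ofReal_ne_top] at hk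
  exact absurd (tendsto_nhds_unique tendsto_const_nhds hk) ENNReal.top_ne_zero

theorem fourierNorm_mul_le_localNorm {ω : WeightFunction} {Ω : TopologicalSpace.Opens (Space d)}
    (ψ : testFunctions ω Ω) {f : Space d → ℂ} (hf : f ∈ ultradiffFunctions ω Ω) {l : ℝ}
    (hl : 0 < l) :
    fourierNorm ω l ((ψ : Space d → ℂ) * f) ≤
      (fourierNorm ω l (ψ : Space d → ℂ) + 1) *
        localNorm ω Ω (tsupport (ψ : Space d → ℂ)) l f := by
  have hψ := ψ.2
  have hfin : fourierNorm ω l (ψ : Space d → ℂ) + 1 ≠ ∞ :=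
    ENNReal.add_ne_top.2 ⟨(hψ.2.2.2 l hl).ne, ENNReal.one_ne_top⟩
  have hpos : fourierNorm ω l (ψ : Space d → ℂ) + 1 ≠ 0 := by simp
  unfold localNorm
  rw [ENNReal.mul_iInf_of_ne hpos hfin]
  refine le_iInf fun χ => ?_
  rw [ENNReal.mul_iInf_of_ne hpos hfin]
  refine le_iInf fun hχ => ?_
  have hχf := hf.2 χ χ.2
  have heq : (ψ : Space d → ℂ) * f = (ψ : Space d → ℂ) * ((χ : Space d → ℂ) * f) := by
    ext x
    by_cases hx : x ∈ tsupport (ψ : Space d → ℂ)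
    · simp [hχ x hx]
    · simp [image_eq_zero_of_notMem_tsupport hx]
  rw [heq]
  refine (fourierNorm_mul_le ω hl.le hψ.1 hψ.2.1 hχf.1 hχf.2.1).trans ?_
  gcongr
  exact le_self_add

theorem IsNegligible.neg {ω : WeightFunction} {Ω : TopologicalSpace.Opens (Space d)}
    {g : Net ω Ω} (hg : IsNegligible g) : IsNegligible (-g) := by
  intro K hK hKΩ h hh k hk
  have hnorm : ∀ f : Space d → ℂ, localNorm ω Ω K h (-f) = localNorm ω Ω K h f := by
    intro f
    unfold localNorm
    refine iInf_congr fun χ => iInf_congr fun _ => ?_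
    have : (χ : Space d → ℂ) * -f = (-1 : ℂ) • ((χ : Space d → ℂ) * f) := by
      ext x
      simp
    rw [this, fourierNorm_smul]
    simp
  have := hg K hK hKΩ h hh k hk
  unfold NormLittleO at this ⊢
  simpa [hnorm] using this

theorem IsNegligible.add {ω : WeightFunction} {Ω : TopologicalSpace.Opens (Space d)}
    {g g' : Net ω Ω} (hg : IsNegligible g) (hg' : IsNegligible g')
    (hcut : ∀ K : Set (Space d), IsCompact K → K ⊆ Ω →
      ∃ χ : testFunctions ω Ω, ∀ x ∈ K, (χ : Space d → ℂ) x = 1) : IsNegligible (g + g') := by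
  intro K hK hKΩ h hh k hk
  obtain ⟨ψ, hψ⟩ := hcut K hK hKΩ
  set K' := tsupport (ψ : Space d → ℂ) with hK'
  set C := fourierNorm ω h (ψ : Space d → ℂ) + 1 with hC
  have hCfin : C ≠ ∞ := ENNReal.add_ne_top.2 ⟨(ψ.2.2.2.2 h hh).ne, ENNReal.one_ne_top⟩
  have h1 := hg K' ψ.2.2.1 ψ.2.2.2.1 h hh k hk
  have h2 := hg' K' ψ.2.2.1 ψ.2.2.2.1 h hh k hk
  have h3 := ENNReal.Tendsto.const_mul (a := C) (h1.add h2) (Or.inr hCfin)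
  rw [add_zero, mul_zero] at h3
  refine tendsto_of_tendsto_of_tendsto_of_le_of_le tendsto_const_nhds h3 (fun _ => zero_le)
    fun ε => ?_
  have hint : ∀ u ∈ ultradiffFunctions ω Ω, Integrable ((ψ : Space d → ℂ) * u) := fun u hu =>
    (hu.2 ψ ψ.2).1.continuous.integrable_of_hasCompactSupport (hu.2 ψ ψ.2).2.1
  have key : localNorm ω Ω K h (((g + g') ε : ultradiffFunctions ω Ω) : Space d → ℂ) ≤
      C * (localNorm ω Ω K' h (g ε : Space d → ℂ) + localNorm ω Ω K' h (g' ε : Space d → ℂ)) := by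
    refine (iInf₂_le ψ hψ).trans ?_
    have : (ψ : Space d → ℂ) * (((g + g') ε : ultradiffFunctions ω Ω) : Space d → ℂ) =
        (ψ : Space d → ℂ) * (g ε : Space d → ℂ) + (ψ : Space d → ℂ) * (g' ε : Space d → ℂ) := by
      rw [← mul_add]
      rfl
    rw [this, mul_add]
    exact (fourierNorm_add_le ω h (hint _ (g ε).2) (hint _ (g' ε).2)).trans
      (add_le_add (fourierNorm_mul_le_localNorm ψ (g ε).2 hh)
        (fourierNorm_mul_le_localNorm ψ (g' ε).2 hh))
  simp only [← ENNReal.add_div, ← mul_div_assoc]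
  exact ENNReal.div_le_div_right key _

/-- Two moderate nets are identified when their difference is negligible. -/
instance generalizedSetoid (ω : WeightFunction) (Ω : TopologicalSpace.Opens (Space d)) :
    Setoid {g : Net ω Ω // IsModerate g} where
  r g g' := IsNegligible (g.1 - g'.1)
  iseqv :=
    { refl := by
        intro g K hK hKΩ h hh k hk
        obtain ⟨χ, hχ⟩ := g.2.exists_cutoff hK hKΩ
        have h0 : localNorm ω Ω K h (0 : Space d → ℂ) = 0 := by
          refine le_antisymm ((iInf₂_le χ hχ).trans ?_) zero_le
          rw [mul_zero, fourierNorm_zero]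
        unfold NormLittleO
        simp [h0]
      symm := by
        intro g g' h
        have := h.neg
        rwa [neg_sub] at this
      trans := by
        intro g g' g'' h h'
        have := h.add h' fun K hK hKΩ => g.2.exists_cutoff hK hKΩ
        rwa [sub_add_sub_cancel] at this }

/-- `𝒢^{(ω)}(Ω) = ℰ_M^{(ω)}(Ω) / 𝒩^{(ω)}(Ω)`: Beurling generalized ultradifferentiable functions. -/
def Generalized (ω : WeightFunction) (Ω : TopologicalSpace.Opens (Space d)) : Type :=
  Quotient (generalizedSetoid ω Ω)

/-- The class `[(g_ε)]` of a moderate net. -/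
def Generalized.mk {ω : WeightFunction} {Ω : TopologicalSpace.Opens (Space d)}
    (g : Net ω Ω) (hg : IsModerate g) : Generalized ω Ω :=
  Quotient.mk (generalizedSetoid ω Ω) ⟨g, hg⟩

/-- `𝒢^{(ω),∞}(Ω)`: the classes that have a regular representative. -/
def Generalized.regular (ω : WeightFunction) (Ω : TopologicalSpace.Opens (Space d)) :
    Set (Generalized ω Ω) :=
  {G | ∃ (g : Net ω Ω) (hg : IsModerate g), Generalized.mk g hg = G ∧ IsRegularNet g}

/-- `T` is strongly associated to the class `G`: for a representative `(g_ε)` of `G` and every compact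
`K ⊆ Ω` there is `b > 0` with `⟨g_ε - T, φ⟩ = o(exp (-b ω(1/ε)))` for all test functions supported in
`K`. Negligible nets do not affect the condition, so the choice of the representative is
immaterial. -/
def StronglyAssociated {ω : WeightFunction} {Ω : TopologicalSpace.Opens (Space d)}
    (T : Ultradistribution ω Ω) (G : Generalized ω Ω) : Prop :=
  ∃ (g : Net ω Ω) (hg : IsModerate g), Generalized.mk g hg = G ∧
    ∀ K : Set (Space d), IsCompact K → K ⊆ Ω → ∃ b : ℝ, 0 < b ∧
      ∀ φ : testFunctions ω Ω, tsupport (φ : Space d → ℂ) ⊆ K →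
        (fun ε => (∫ x, (g ε : Space d → ℂ) x * (φ : Space d → ℂ) x) - T.toLinearMap φ)
          =o[epsFilter] fun ε => Real.exp (-b * ω (1 / (ε : ℝ)))

end BeurlingBjorck

end

noncomputable section

namespace BeurlingBjorck

variable {d : ℕ}

/-! ### Growth of weight functions -/

/-! Sample the net along parameters with ω(1/ε) = n + c and write g_n for its members. Tested
against any ψ supported in supp φ, the increment g_{n+1} - g_n is O(e^{-bn}), because T cancels;
this is strong association. Regularity says that φ(g_{n+1} - g_n) is O(e^{kn}) in every norm ‖·‖_h,
with one k for all h.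

These two facts are interpolated in frequency (`tsum_fourierNorm_ne_top`). Where ω(|ξ|) ≤ δn with δ
small, the decay e^{-bn} wins. Where ω(|ξ|) ≥ δn, passing from h to a larger h' gains e^{-(h'-h)δn},
and since k does not depend on h', this beats e^{kn}. Hence the increments are summable in every
norm, φ g_n converges to a test function Z_φ, Tφ = ∫ Z_φ, and the pointwise limit f of the g_n
satisfies φ f = Z_φ.

The interpolation needs decay that is uniform over the modulated functions exp(-2πi x·ξ) φ up to a
factor e^{lω(|ξ|)}, whereas association gives a constant for each ψ separately.
`exists_uniform_exp_bound` closes this gap by Banach–Steinhaus, applied on ℓ¹ through rapidly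
convergent superpositions of modulated copies of φ rather than on the Fréchet space of test
functions. -/

theorem exists_one_add_rpow_le_exp (ω : WeightFunction) (m : ℝ) :
    ∃ C : ℝ, 0 < C ∧ ∀ t : ℝ, 0 ≤ t → (1 + t) ^ m ≤ C * Real.exp (ω t) := by
  obtain ⟨t₀, ht₀⟩ := eventually_atTop.1 (ω.log_littleO'.eventually_ge_atTop m)
  -- The constant takes care of t ≤ |t₀|; beyond that, m log(1 + t) ≤ ω(t). The absolute value of m
  -- covers negative exponents.
  refine ⟨(1 + |t₀|) ^ |m|, by positivity, fun t ht => ?_⟩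
  have h1 : 1 ≤ (1 + |t₀|) ^ |m| :=
    Real.one_le_rpow (by linarith [abs_nonneg t₀]) (abs_nonneg m)
  have h2 : 1 ≤ Real.exp (ω t) := Real.one_le_exp (ω.nonneg' t ht)
  rcases le_or_gt t |t₀| with h | h
  · calc (1 + t) ^ m ≤ (1 + t) ^ |m| :=
          Real.rpow_le_rpow_of_exponent_le (by linarith) (le_abs_self m)
      _ ≤ (1 + |t₀|) ^ |m| := Real.rpow_le_rpow (by linarith) (by linarith) (abs_nonneg m)
      _ ≤ _ := le_mul_of_one_le_right (by positivity) h2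
  · have hlog : 0 < Real.log (1 + t) :=
      Real.log_pos (by linarith [abs_nonneg t₀])
    have h3 := (le_div_iff₀ hlog).1 (ht₀ t ((le_abs_self t₀).trans h.le))
    calc (1 + t) ^ m = Real.exp (m * Real.log (1 + t)) := by
          rw [Real.rpow_def_of_pos (by linarith), mul_comm]
      _ ≤ Real.exp (ω t) := Real.exp_le_exp.2 h3
      _ ≤ _ := le_mul_of_one_le_left (by positivity) h1

/-- ω dominates (d + 1) log(1 + t), and (1 + |ξ|)^{-(d+1)} is integrable. This turns pointwise
Fourier bounds into norm bounds. -/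
theorem lintegral_exp_neg_weight_lt_top (ω : WeightFunction) :
    ∫⁻ ξ : Space d, ENNReal.ofReal (Real.exp (-ω ‖ξ‖)) < ∞ := by
  obtain ⟨C, hC, h⟩ := exists_one_add_rpow_le_exp ω (d + 1)
  have hint : Integrable fun ξ : Space d => C * (1 + ‖ξ‖) ^ (-(d + 1 : ℝ)) :=
    (integrable_one_add_norm (by simp)).const_mul C
  refine lt_of_le_of_lt (lintegral_mono fun ξ => ENNReal.ofReal_le_ofReal ?_) hint.lintegral_lt_top
  have hp : (0 : ℝ) < (1 + ‖ξ‖) ^ (d + 1 : ℝ) := by positivity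
  rw [Real.exp_neg, Real.rpow_neg (by positivity), ← div_eq_mul_inv, le_div_iff₀ hp,
    inv_mul_le_iff₀ (Real.exp_pos _), mul_comm]
  exact h _ (norm_nonneg ξ)

theorem tendsto_weight_atTop (ω : WeightFunction) : Tendsto ω.toFun atTop atTop := by
  have hlog : Tendsto (fun t : ℝ => Real.log (1 + t)) atTop atTop :=
    Real.tendsto_log_atTop.comp (tendsto_atTop_add_const_left _ 1 tendsto_id)
  refine (ω.log_littleO'.atTop_mul_atTop₀ hlog).congr' ?_
  filter_upwards [eventually_gt_atTop 0] with t ht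
  exact div_mul_cancel₀ _ (Real.log_pos (by linarith)).ne'

/-- A sequence of parameters tending to `0` along which `ω (1 / ε)` grows linearly. -/
theorem exists_seq_weight_eq (ω : WeightFunction) :
    ∃ (e : ℕ → Set.Ioo (0 : ℝ) 1) (c : ℝ), Tendsto e atTop epsFilter ∧
      ∀ n : ℕ, ω (1 / (e n : ℝ)) = n + c := by
  -- Intermediate value theorem. The offset ω(1) + 1 keeps the value above ω(1), so s > 1 strictly
  -- and 1/s lies in (0, 1).
  have hex : ∀ n : ℕ, ∃ s : ℝ, 1 < s ∧ ω s = n + (ω 1 + 1) := by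
    intro n
    obtain ⟨B, hB1, hB⟩ := ((eventually_ge_atTop 1).and
      ((tendsto_weight_atTop ω).eventually_ge_atTop (n + (ω 1 + 1)))).exists
    obtain ⟨s, hs, hs'⟩ := intermediate_value_Icc hB1
      (ω.continuousOn'.mono fun x hx => zero_le_one.trans hx.1)
      (⟨by linarith [n.cast_nonneg (α := ℝ)], hB⟩ :
        (n + (ω 1 + 1) : ℝ) ∈ Set.Icc (ω 1) (ω B))
    refine ⟨s, lt_of_le_of_ne hs.1 ?_, hs'⟩
    rintro rfl
    linarith [n.cast_nonneg (α := ℝ)]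
  choose s hs1 hs using hex
  have hs_top : Tendsto s atTop atTop := by
    refine tendsto_atTop.2 fun B => ?_
    obtain ⟨N, hN⟩ := exists_nat_gt (ω |B|)
    filter_upwards [eventually_ge_atTop N] with n hn
    by_contra! hlt
    have h1 := ω.monotoneOn' (Set.mem_Ici.2 (zero_le_one.trans (hs1 n).le))
      (Set.mem_Ici.2 (abs_nonneg B)) (hlt.le.trans (le_abs_self B))
    have h2 : (N : ℝ) ≤ n := by exact_mod_cast hn
    linarith [hs n, ω.nonneg' 1 zero_le_one]
  refine ⟨fun n => ⟨(s n)⁻¹, inv_pos.2 (zero_lt_one.trans (hs1 n)), inv_lt_one_of_one_lt₀ (hs1 n)⟩,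
    ω 1 + 1, tendsto_comap_iff.2 (tendsto_inv_atTop_zero.comp hs_top),
    fun n => by simpa using hs n⟩

/-! ### A uniform boundedness principle -/

/-- Functions on `X` that are bounded, uniformly in the index, when paired with every measure
`∑ c j • δ (x j)` of rapid decay with respect to `W`, have uniform growth at most exponential
in `W`. -/
theorem exists_uniform_exp_bound {X : Type*} {W : X → ℝ} (hW : ∀ x, 0 ≤ W x) {D : ℕ → X → ℂ}
    (hD : ∀ n, ∃ M, ∀ x, ‖D n x‖ ≤ M)
    (h : ∀ (x : ℕ → X) (c : ℕ → ℂ),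
      (∀ l : ℝ, 0 < l → Summable fun j => ‖c j‖ * Real.exp (l * W (x j))) →
      ∃ M, ∀ n, ‖∑' j, c j * D n (x j)‖ ≤ M) :
    ∃ C l : ℝ, 0 < C ∧ 0 < l ∧ ∀ n x, ‖D n x‖ ≤ C * Real.exp (l * W x) := by
  by_contra! hcon
  have hpos : ∀ j : ℕ, (0 : ℝ) < j + 1 := fun j => by positivity
  -- Gliding counterexamples: ‖D (n j) (x j)‖ exceeds (j + 1) exp((j + 1) W(x j)). The weights w j
  -- below cancel exactly this exponential.
  choose n x hx using fun j : ℕ => hcon (j + 1) (j + 1) (hpos j) (hpos j)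
  set w : ℕ → ℝ := fun j => Real.exp (-((j + 1) * W (x j))) with hw
  have hw0 : ∀ j, 0 < w j := fun j => Real.exp_pos _
  have hw1 : ∀ j, w j ≤ 1 := fun j =>
    Real.exp_le_one_iff.2 (neg_nonpos.2 (mul_nonneg (hpos j).le (hW _)))
  -- The bounds M k serve only to make each functional L k continuous on ℓ¹; uniformity in k comes
  -- from Banach–Steinhaus.
  choose M hM using hD
  have hnorm : ∀ a : lp (fun _ : ℕ => ℂ) 1, Summable fun j => ‖a j‖ := fun a => by
    simpa using (lp.memℓp a).summable (by simp)
  have hM' : ∀ k j, ‖(w j : ℂ) * D k (x j)‖ ≤ M k := fun k j => by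
    rw [norm_mul, Complex.norm_of_nonneg (hw0 j).le]
    exact (mul_le_of_le_one_left (norm_nonneg _) (hw1 j)).trans (hM k _)
  have hle : ∀ k (a : lp (fun _ : ℕ => ℂ) 1) j,
      ‖a j * ((w j : ℂ) * D k (x j))‖ ≤ ‖a j‖ * M k := fun k a j => by
    rw [norm_mul]
    exact mul_le_mul_of_nonneg_left (hM' k j) (norm_nonneg _)
  have hsum : ∀ k (a : lp (fun _ : ℕ => ℂ) 1),
      Summable fun j => a j * ((w j : ℂ) * D k (x j)) := fun k a =>
    .of_norm_bounded ((hnorm a).mul_right (M k)) (hle k a)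
  let L : ℕ → lp (fun _ : ℕ => ℂ) 1 →L[ℂ] ℂ := fun k => LinearMap.mkContinuous
    { toFun := fun a => ∑' j, a j * ((w j : ℂ) * D k (x j))
      map_add' := fun a b => by
        rw [← (hsum k a).tsum_add (hsum k b)]
        simp [add_mul]
      map_smul' := fun c a => by
        simp [mul_assoc, tsum_mul_left] } (M k) fun a => by
    have h1 := tsum_of_norm_bounded ((hnorm a).mul_right (M k)).hasSum (hle k a)
    rw [tsum_mul_right, mul_comm] at h1
    have h2 : ‖a‖ = ∑' j, ‖a j‖ := by
      simpa using lp.norm_eq_tsum_rpow (by simp) a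
    rw [h2]
    exact h1
  obtain ⟨B, hB⟩ := banach_steinhaus (g := L) fun a => by
    obtain ⟨B, hB⟩ := h x (fun j => a j * w j) fun l hl => by
      -- For j ≥ J the factor w j · exp(l W(x j)) is at most 1, so from there on the series is
      -- dominated by ∑ ‖a j‖.
      obtain ⟨J, hJ⟩ := exists_nat_ge l
      refine (summable_nat_add_iff J).1 ?_
      refine .of_nonneg_of_le (fun j => by positivity) (fun j => ?_)
        ((summable_nat_add_iff J).2 (hnorm a))
      rw [norm_mul, Complex.norm_of_nonneg (hw0 _).le, mul_assoc]
      refine mul_le_of_le_one_right (norm_nonneg _) ?_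
      simp only [hw]
      rw [← Real.exp_add]
      refine Real.exp_le_one_iff.2 ?_
      have := mul_le_mul_of_nonneg_right (hJ.trans
        (show (J : ℝ) ≤ ((j + J : ℕ) : ℝ) + 1 by
          push_cast; linarith [j.cast_nonneg (α := ℝ)])) (hW (x (j + J)))
      linarith
    refine ⟨B, fun k => ?_⟩
    simpa [L, mul_assoc] using hB k
  -- On the j-th unit vector, L (n j) has modulus greater than j + 1, which contradicts the uniform
  -- bound B.
  obtain ⟨j, hj⟩ := exists_nat_gt B
  have h1 := (L (n j)).le_opNorm (lp.single 1 j 1)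
  have h2 : L (n j) (lp.single 1 j 1) = w j * D (n j) (x j) := by
    simp only [L, LinearMap.mkContinuous_apply, LinearMap.coe_mk, AddHom.coe_mk]
    rw [tsum_eq_single j]
    · simp
    · intro i hi
      simp [lp.single_apply, hi]
  rw [h2, lp.norm_single (by simp), norm_one, mul_one, norm_mul,
    Complex.norm_of_nonneg (hw0 j).le] at h1
  have h3 := mul_lt_mul_of_pos_left (hx j) (hw0 j)
  have h4 : w j * ((j + 1) * Real.exp ((j + 1) * W (x j))) = j + 1 := by
    rw [mul_left_comm, ← Real.exp_add, neg_add_cancel, Real.exp_zero, mul_one]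
  linarith [hB (n j)]

/-! ### Basic properties of the Fourier norms -/

theorem ofReal_exp_weight_mono (ω : WeightFunction) {l l' : ℝ} (h : l ≤ l') (ξ : Space d) :
    ENNReal.ofReal (Real.exp (l * ω ‖ξ‖)) ≤ ENNReal.ofReal (Real.exp (l' * ω ‖ξ‖)) :=
  ENNReal.ofReal_le_ofReal (Real.exp_le_exp.2
    (mul_le_mul_of_nonneg_right h (ω.nonneg' _ (norm_nonneg ξ))))

theorem lintegral_enorm_fourier_le (ω : WeightFunction) {l : ℝ} (hl : 0 ≤ l) (f : Space d → ℂ) :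
    ∫⁻ ξ, ‖𝓕 f ξ‖ₑ ≤ fourierNorm ω l f := by
  refine lintegral_mono fun ξ => le_mul_of_one_le_right zero_le ?_
  simpa using ofReal_exp_weight_mono ω hl ξ

theorem continuous_fourier {f : Space d → ℂ} (hf : Integrable f) : Continuous (𝓕 f) :=
  VectorFourier.fourierIntegral_continuous Real.continuous_fourierChar
    (by exact continuous_inner) hf

theorem measurable_enorm_fourier_mul_weight (ω : WeightFunction) (l : ℝ) {f : Space d → ℂ}
    (hf : Integrable f) :
    Measurable fun ξ => ‖𝓕 f ξ‖ₑ * ENNReal.ofReal (Real.exp (l * ω ‖ξ‖)) :=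
  (continuous_fourier hf).enorm.measurable.mul (measurable_weight ω l)

theorem integrable_fourier {ω : WeightFunction} {l : ℝ} (hl : 0 ≤ l) {f : Space d → ℂ}
    (hf : Integrable f) (h : fourierNorm ω l f < ∞) : Integrable (𝓕 f) :=
  ⟨(continuous_fourier hf).aestronglyMeasurable, (lintegral_enorm_fourier_le ω hl f).trans_lt h⟩

/-- Fourier inversion: the sup norm is at most the L¹ norm of the transform, and the weight is at
least 1. -/
theorem enorm_apply_le_fourierNorm (ω : WeightFunction) {l : ℝ} (hl : 0 ≤ l) {f : Space d → ℂ}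
    (hfc : Continuous f) (hf : Integrable f) (x : Space d) : ‖f x‖ₑ ≤ fourierNorm ω l f := by
  rcases eq_or_ne (fourierNorm ω l f) ∞ with h | h
  · simp [h]
  have hF := integrable_fourier hl hf h.lt_top
  rw [← congrFun (hfc.fourierInv_fourier_eq hf hF) x, Real.fourierInv_eq]
  refine (enorm_integral_le_lintegral_enorm _).trans (le_trans (lintegral_mono fun ξ => ?_)
    (lintegral_enorm_fourier_le ω hl f))
  rw [← ofReal_norm, Circle.norm_smul, ofReal_norm]

/-- The weight e^{ω} dominates every polynomial, so all moments of the transform are integrable and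
the inversion integral can be differentiated arbitrarily often. -/
theorem contDiff_of_fourierNorm_lt_top (ω : WeightFunction) {l : ℝ} (hl : 1 ≤ l) {f : Space d → ℂ}
    (hfc : Continuous f) (hf : Integrable f) (h : fourierNorm ω l f < ∞) :
    ContDiff ℝ ((⊤ : ℕ∞) : WithTop ℕ∞) f := by
  have hF := integrable_fourier (zero_le_one.trans hl) hf h
  have hinv : f = fun x => 𝓕 (𝓕 f) (-x) := by
    rw [← funext fun x => Real.fourierInv_eq_fourier_neg (𝓕 f) x]
    exact (hfc.fourierInv_fourier_eq hf hF).symm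
  rw [hinv]
  refine ContDiff.comp (Real.contDiff_fourier fun n _ => ?_) contDiff_neg
  obtain ⟨C, hC, hle⟩ := exists_one_add_rpow_le_exp ω n
  refine ⟨((continuous_norm.pow n).mul (continuous_fourier hf).norm).aestronglyMeasurable, ?_⟩
  refine lt_of_le_of_lt ?_ (ENNReal.mul_lt_top (ENNReal.ofReal_lt_top (r := C)) h)
  rw [fourierNorm, ← lintegral_const_mul _ (measurable_enorm_fourier_mul_weight ω l hf)]
  refine lintegral_mono fun ξ => ?_
  rw [enorm_mul, enorm_norm, mul_left_comm, mul_comm]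
  gcongr
  rw [← ENNReal.ofReal_mul hC.le, Real.enorm_of_nonneg (by positivity)]
  refine ENNReal.ofReal_le_ofReal ?_
  calc ‖ξ‖ ^ n ≤ (1 + ‖ξ‖) ^ n := by gcongr; linarith
    _ = (1 + ‖ξ‖) ^ (n : ℝ) := (Real.rpow_natCast _ _).symm
    _ ≤ C * Real.exp (ω ‖ξ‖) := hle _ (norm_nonneg ξ)
    _ ≤ _ := by
      gcongr
      exact le_mul_of_one_le_left (ω.nonneg' _ (norm_nonneg ξ)) hl

/-! ### Test functions -/

section TestFunctions

variable {ω : WeightFunction} {Ω : TopologicalSpace.Opens (Space d)}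

theorem integrable_of_mem_testFunctions {φ : Space d → ℂ} (hφ : φ ∈ testFunctions ω Ω) :
    Integrable φ :=
  hφ.1.continuous.integrable_of_hasCompactSupport hφ.2.1

theorem norm_apply_le_fourierNorm {φ : Space d → ℂ} (hφ : φ ∈ testFunctions ω Ω) (x : Space d) :
    ‖φ x‖ ≤ (fourierNorm ω 1 φ).toReal := by
  rw [← toReal_enorm]
  exact ENNReal.toReal_mono (hφ.2.2.2 1 one_pos).ne
    (enorm_apply_le_fourierNorm ω zero_le_one hφ.1.continuous
      (integrable_of_mem_testFunctions hφ) x)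

theorem integral_norm_le_of_forall_notMem {K : Set (Space d)} (hK : IsCompact K)
    {f : Space d → ℂ} (hf : ∀ x ∉ K, f x = 0) {B : ℝ} (hB : ∀ x ∈ K, ‖f x‖ ≤ B) :
    ∫ x, ‖f x‖ ≤ B * volume.real K := by
  rw [← setIntegral_eq_integral_of_forall_compl_eq_zero (s := K) fun x hx => by simp [hf x hx]]
  have h := norm_setIntegral_le_of_norm_le_const (μ := volume) (f := fun x => ‖f x‖)
    hK.measure_lt_top (fun x hx => by simpa using hB x hx)
  exact (le_abs_self _).trans h

theorem integrable_mul_of_forall_notMem {K : Set (Space d)} (hK : IsCompact K)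
    {G w : Space d → ℂ} (hG : ContinuousOn G K) (hw : Continuous w) (hwK : ∀ x ∉ K, w x = 0) :
    Integrable fun x => G x * w x := by
  refine (integrableOn_iff_integrable_of_support_subset (s := K) fun x hx => ?_).1
    ((hG.mul hw.continuousOn).integrableOn_compact hK)
  by_contra h
  exact hx (by simp [hwK x h])

/-- Continuity of G is required on K alone, because G may be an ultradifferentiable function, whose
values off Ω are arbitrary. -/
theorem hasSum_integral_mul {K : Set (Space d)} (hK : IsCompact K) {w : ℕ → Space d → ℂ}
    (hw : ∀ n, Continuous (w n)) (hwK : ∀ n, ∀ x ∉ K, w n x = 0) {b : ℕ → ℝ} (hb : Summable b)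
    (hwb : ∀ n x, ‖w n x‖ ≤ b n) {G : Space d → ℂ} (hG : ContinuousOn G K) :
    HasSum (fun n => ∫ x, G x * w n x) (∫ x, G x * ∑' n, w n x) := by
  obtain ⟨M, hM⟩ := hK.exists_bound_of_continuousOn hG
  have hint : ∀ n, Integrable fun x => G x * w n x := fun n =>
    integrable_mul_of_forall_notMem hK hG (hw n) (hwK n)
  have h := hasSum_integral_of_summable_integral_norm hint (by
    refine .of_nonneg_of_le (fun n => integral_nonneg fun x => norm_nonneg _) (fun n => ?_)
      ((hb.mul_left M).mul_right (volume.real K))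
    refine integral_norm_le_of_forall_notMem hK (fun x hx => by simp [hwK n x hx]) fun x hx => ?_
    rw [norm_mul]
    exact mul_le_mul (hM x hx) (hwb n x) (norm_nonneg _) ((norm_nonneg _).trans (hM x hx)))
  simpa only [tsum_mul_left] using h

/-- The character `x ↦ exp (-2πi x·ξ)`. -/
def character (ξ x : Space d) : ℂ := (Real.fourierChar (-inner ℝ x ξ) : ℂ)

theorem contDiff_character (ξ : Space d) :
    ContDiff ℝ ((⊤ : ℕ∞) : WithTop ℕ∞) (character ξ) := by
  unfold character
  simp only [Real.fourierChar_apply]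
  exact Complex.contDiff_exp.comp ((Complex.ofRealCLM.contDiff.comp
    (contDiff_const.mul (contDiff_id.inner ℝ contDiff_const).neg)).mul contDiff_const)

theorem fourier_eq_integral_character_mul (f : Space d → ℂ) (ξ : Space d) :
    𝓕 f ξ = ∫ x, character ξ x * f x := by
  rw [Real.fourier_eq]
  rfl

theorem fourier_character_mul (f : Space d → ℂ) (ξ η : Space d) :
    𝓕 (character ξ * f) η = 𝓕 f (η + ξ) := by
  simp only [fourier_eq_integral_character_mul, Pi.mul_apply]
  congr 1 with x
  rw [← mul_assoc]
  congr 1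
  simp only [character, inner_add_right, neg_add, AddChar.map_add_eq_mul, Circle.coe_mul]

/-- Modulation translates the transform by ξ, and subadditivity of ω bounds the cost by e^{lω(|ξ|)}.
-/
theorem fourierNorm_character_mul_le (ω : WeightFunction) {l : ℝ} (hl : 0 ≤ l)
    (f : Space d → ℂ) (ξ : Space d) :
    fourierNorm ω l (character ξ * f) ≤
      ENNReal.ofReal (Real.exp (l * ω ‖ξ‖)) * fourierNorm ω l f := by
  unfold fourierNorm
  rw [← lintegral_const_mul' _ _ ENNReal.ofReal_ne_top,
    ← lintegral_add_right_eq_self (μ := volume) (g := ξ)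
      (f := fun η => ENNReal.ofReal (Real.exp (l * ω ‖ξ‖)) *
        (‖𝓕 f η‖ₑ * ENNReal.ofReal (Real.exp (l * ω ‖η‖))))]
  refine lintegral_mono fun η => ?_
  simp only [fourier_character_mul]
  rw [mul_left_comm, ← ENNReal.ofReal_mul (Real.exp_pos _).le, ← Real.exp_add, ← mul_add]
  gcongr
  have h0 : ‖η‖ ≤ ‖ξ‖ + ‖η + ξ‖ := by
    have := norm_add_le (-ξ) (η + ξ)
    simpa using this
  exact (ω.monotoneOn' (norm_nonneg η) (add_nonneg (norm_nonneg _) (norm_nonneg _)) h0).trans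
    (ω.subadd' _ _ (norm_nonneg _) (norm_nonneg _))

theorem character_mul_mem_testFunctions {φ : Space d → ℂ} (hφ : φ ∈ testFunctions ω Ω)
    (ξ : Space d) : character ξ * φ ∈ testFunctions ω Ω :=
  ⟨(contDiff_character ξ).mul hφ.1, hφ.2.1.mul_left,
    (tsupport_mul_subset_right (f := character ξ)).trans hφ.2.2.1, fun l hl =>
    (fourierNorm_character_mul_le ω hl.le φ ξ).trans_lt
      (ENNReal.mul_lt_top ENNReal.ofReal_lt_top (hφ.2.2.2 l hl))⟩

/-- A series of test functions with supports in a fixed compact set that converges absolutely for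
all the norms `‖·‖_l^ω` has a test function as its sum. -/
theorem tsum_mem_testFunctions {K : Set (Space d)} (hK : IsCompact K) (hKΩ : K ⊆ Ω)
    {w : ℕ → Space d → ℂ} (hw : ∀ n, w n ∈ testFunctions ω Ω) (hwK : ∀ n, ∀ x ∉ K, w n x = 0)
    (hsum : ∀ l : ℝ, 0 < l → ∑' n, fourierNorm ω l (w n) ≠ ∞) :
    (fun x => ∑' n, w n x) ∈ testFunctions ω Ω := by
  have hb := ENNReal.summable_toReal (hsum 1 one_pos)
  have hwb := fun n => norm_apply_le_fourierNorm (hw n)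
  have hcont : Continuous fun x => ∑' n, w n x :=
    continuous_tsum (fun n => (hw n).1.continuous) hb hwb
  have hsupp : tsupport (fun x => ∑' n, w n x) ⊆ K := by
    refine closure_minimal (fun x hx => ?_) hK.isClosed
    by_contra h
    exact hx (by simp [fun n => hwK n x h])
  have hcpt : HasCompactSupport fun x => ∑' n, w n x :=
    hK.of_isClosed_subset (isClosed_tsupport _) hsupp
  have hint := hcont.integrable_of_hasCompactSupport hcpt (μ := volume)
  have hfour : ∀ ξ, 𝓕 (fun x => ∑' n, w n x) ξ = ∑' n, 𝓕 (w n) ξ := fun ξ => by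
    simp only [fourier_eq_integral_character_mul]
    exact (hasSum_integral_mul hK (fun n => (hw n).1.continuous) hwK hb hwb
      (contDiff_character ξ).continuous.continuousOn).tsum_eq.symm
  have hfin : ∀ l : ℝ, 0 < l → fourierNorm ω l (fun x => ∑' n, w n x) < ∞ := fun l hl => by
    refine lt_of_le_of_lt ?_ (hsum l hl).lt_top
    unfold fourierNorm
    rw [← lintegral_tsum fun n => (measurable_enorm_fourier_mul_weight ω l
      (integrable_of_mem_testFunctions (hw n))).aemeasurable]
    refine lintegral_mono fun ξ => ?_
    rw [ENNReal.tsum_mul_right, hfour]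
    gcongr
    exact enorm_tsum_le_tsum_enorm
  -- Smoothness is read off from the finite norm of the sum, without differentiating term by term.
  exact ⟨contDiff_of_fourierNorm_lt_top ω le_rfl hcont hint (hfin 1 one_pos), hcpt,
    hsupp.trans hKΩ, hfin⟩

end TestFunctions

/-! ### From weak decay and uniform growth to convergence of test functions -/

section Regularity

variable {ω : WeightFunction} {Ω : TopologicalSpace.Opens (Space d)}

/-- Pairings that decay exponentially on every test function supported in `tsupport φ` are controlled
uniformly on the functions `exp (-2πi x·ξ) φ`. -/
theorem exists_fourier_mul_bound {u : ℕ → Space d → ℂ}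
    (hu : ∀ n, u n ∈ ultradiffFunctions ω Ω) {φ : Space d → ℂ} (hφ : φ ∈ testFunctions ω Ω) {b : ℝ}
    (h : ∀ ψ ∈ testFunctions ω Ω, tsupport ψ ⊆ tsupport φ →
      ∃ M, ∀ n : ℕ, ‖∫ x, u n x * ψ x‖ ≤ M * Real.exp (-b * n)) :
    ∃ C l : ℝ, 0 < C ∧ 0 < l ∧ ∀ (n : ℕ) (ξ : Space d),
      ‖𝓕 (φ * u n) ξ‖ ≤ C * Real.exp (-b * n) * Real.exp (l * ω ‖ξ‖) := by
  have hexp : ∀ n : ℕ, ‖(Real.exp (b * n) : ℂ)‖ = Real.exp (b * n) := fun n =>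
    Complex.norm_of_nonneg (Real.exp_pos _).le
  have hexp' : ∀ n : ℕ, Real.exp (b * n) * Real.exp (-b * n) = 1 := fun n => by
    rw [← Real.exp_add, neg_mul, add_neg_cancel, Real.exp_zero]
  obtain ⟨C, l, hC, hl, hCl⟩ := exists_uniform_exp_bound (X := Space d) (W := fun ξ => ω ‖ξ‖)
    -- The factor e^{bn} normalises the expected decay, so the claim becomes a bound uniform in n.
    (D := fun n ξ => Real.exp (b * n) * 𝓕 (φ * u n) ξ)
    (fun ξ => ω.nonneg' _ (norm_nonneg ξ))
    (fun n => ⟨Real.exp (b * n) * ∫ x, ‖(φ * u n) x‖, fun ξ => by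
      rw [norm_mul, hexp]
      gcongr
      exact VectorFourier.norm_fourierIntegral_le_integral_norm _ _ _ _ _⟩)
    (fun x c hc => by
      have hw : ∀ j, c j • (character (x j) * φ) ∈ testFunctions ω Ω := fun j =>
        Submodule.smul_mem _ _ (character_mul_mem_testFunctions hφ (x j))
      have hwK : ∀ j, ∀ y ∉ tsupport φ, (c j • (character (x j) * φ)) y = 0 := fun j y hy => by
        simp [image_eq_zero_of_notMem_tsupport hy]
      have hsum : ∀ l : ℝ, 0 < l →
          ∑' j, fourierNorm ω l (c j • (character (x j) * φ)) ≠ ∞ := fun l hl => by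
        have h1 : ∑' j, ENNReal.ofReal (‖c j‖ * Real.exp (l * ω ‖x j‖)) * fourierNorm ω l φ ≠ ∞ := by
          rw [ENNReal.tsum_mul_right]
          exact ENNReal.mul_ne_top (hc l hl).tsum_ofReal_ne_top (hφ.2.2.2 l hl).ne
        refine ne_top_of_le_ne_top h1 (ENNReal.tsum_le_tsum fun j => ?_)
        rw [fourierNorm_smul, ENNReal.ofReal_mul (norm_nonneg _), ofReal_norm, mul_assoc]
        gcongr
        exact fourierNorm_character_mul_le ω hl.le φ (x j)
      -- The superposition ∑ c j exp(-2πi y·x j) φ(y) is one test function supported in supp φ, so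
      -- the hypothesis applies to it; its pairing with u n is ∑ c j 𝓕(φ u n)(x j).
      have hψ := tsum_mem_testFunctions hφ.2.1 hφ.2.2.1 hw hwK hsum
      obtain ⟨M, hM⟩ := h _ hψ (closure_minimal (fun y hy => by
        by_contra hy'
        exact hy (by simp [fun j => hwK j y hy'])) (isClosed_tsupport φ))
      refine ⟨M, fun n => ?_⟩
      have h2 := (hasSum_integral_mul hφ.2.1 (fun j => (hw j).1.continuous) hwK
        (ENNReal.summable_toReal (hsum 1 one_pos)) (fun j => norm_apply_le_fourierNorm (hw j))
        ((hu n).1.continuousOn.mono hφ.2.2.1)).tsum_eq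
      have h3 : ∀ j, ∫ y, u n y * (c j • (character (x j) * φ)) y = c j * 𝓕 (φ * u n) (x j) := by
        intro j
        rw [fourier_eq_integral_character_mul, ← integral_const_mul]
        congr 1 with y
        simp only [Pi.smul_apply, Pi.mul_apply, smul_eq_mul]
        ring
      simp only [h3] at h2
      simp only [mul_left_comm (c _), tsum_mul_left]
      rw [h2, norm_mul, hexp]
      calc _ ≤ Real.exp (b * n) * (M * Real.exp (-b * n)) := by
            gcongr
            exact hM n
        _ = M := by rw [mul_left_comm, hexp', mul_one])
  refine ⟨C, l, hC, hl, fun n ξ => ?_⟩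
  have h1 := hCl n ξ
  rw [norm_mul, hexp] at h1
  calc ‖𝓕 (φ * u n) ξ‖
      = Real.exp (-b * n) * (Real.exp (b * n) * ‖𝓕 (φ * u n) ξ‖) := by
        rw [← mul_assoc, mul_comm (Real.exp (-b * n)), hexp', one_mul]
    _ ≤ Real.exp (-b * n) * (C * Real.exp (l * ω ‖ξ‖)) := by gcongr
    _ = _ := by ring

/-- Exponential decay in a weak norm and exponential growth, at a rate independent of `h`, in all
norms `‖·‖_h^ω` interpolate to absolute summability in all norms. -/
theorem tsum_fourierNorm_ne_top {z : ℕ → Space d → ℂ} (hz : ∀ n, Integrable (z n))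
    {b k l C : ℝ} (hb : 0 < b) (hl : 0 ≤ l)
    (hdecay : ∀ (n : ℕ) ξ, ‖𝓕 (z n) ξ‖ ≤ C * Real.exp (-b * n) * Real.exp (l * ω ‖ξ‖))
    (hfin : ∀ h : ℝ, 0 < h → ∀ n, fourierNorm ω h (z n) < ∞)
    (hk : 0 < k)
    (hgrow : ∀ h : ℝ, 0 < h → ∃ A : ℝ, ∀ᶠ n : ℕ in atTop,
      fourierNorm ω h (z n) ≤ ENNReal.ofReal (A * Real.exp (k * n)))
    {h : ℝ} (hh : 0 < h) : ∑' n, fourierNorm ω h (z n) ≠ ∞ := by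
  -- For ω(|ξ|) ≤ δn the loss e^{(h+l+1)ω(|ξ|)} is at most e^{bn/2}; the summand 1 leaves a factor
  -- e^{-ω(|ξ|)} for integrability.
  set δ : ℝ := b / (2 * (h + l + 1)) with hδ
  have hδ0 : 0 < δ := by positivity
  have hδb : (h + l + 1) * δ = b / 2 := by
    rw [hδ]
    field_simp
  -- For ω(|ξ|) ≥ δn one has (h' - h) ω(|ξ|) ≥ (k + 1) n, which beats the growth e^{kn} by a factor
  -- e^{-n}.
  set h' : ℝ := h + (k + 1) / δ with hh'
  have hh'0 : 0 < h' := by positivity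
  have hC : 0 ≤ C := by
    have h1 := (norm_nonneg _).trans (hdecay 0 0)
    rw [mul_assoc] at h1
    exact nonneg_of_mul_nonneg_left h1 (by positivity)
  obtain ⟨A, hA⟩ := hgrow h' hh'0
  set I : ℝ≥0∞ := ∫⁻ ξ : Space d, ENNReal.ofReal (Real.exp (-ω ‖ξ‖)) with hI
  have hI' : I ≠ ∞ := (lintegral_exp_neg_weight_lt_top ω).ne
  have hpt : ∀ (n : ℕ) (ξ : Space d),
      ‖𝓕 (z n) ξ‖ * Real.exp (h * ω ‖ξ‖) ≤ C * Real.exp (-(b / 2) * n) * Real.exp (-ω ‖ξ‖) +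
        Real.exp (-(k + 1) * n) * (‖𝓕 (z n) ξ‖ * Real.exp (h' * ω ‖ξ‖)) := by
    intro n ξ
    rcases le_total (ω ‖ξ‖) (δ * n) with hle | hle
    · refine le_add_of_le_of_nonneg ?_ (by positivity)
      calc ‖𝓕 (z n) ξ‖ * Real.exp (h * ω ‖ξ‖)
          ≤ C * Real.exp (-b * n) * Real.exp (l * ω ‖ξ‖) * Real.exp (h * ω ‖ξ‖) := by
            gcongr
            exact hdecay n ξ
        _ = C * Real.exp (-b * n + l * ω ‖ξ‖ + h * ω ‖ξ‖) := by
            rw [Real.exp_add, Real.exp_add]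
            ring
        _ ≤ C * Real.exp (-(b / 2) * n + -ω ‖ξ‖) := by
            refine mul_le_mul_of_nonneg_left (Real.exp_le_exp.2 ?_) hC
            have h1 := mul_le_mul_of_nonneg_left hle (by positivity : 0 ≤ h + l + 1)
            rw [← mul_assoc, hδb] at h1
            linarith
        _ = _ := by
            rw [Real.exp_add]
            ring
    · refine le_add_of_nonneg_of_le (by positivity) ?_
      rw [mul_left_comm, ← Real.exp_add]
      gcongr
      have h1 := mul_le_mul_of_nonneg_left hle (by positivity : 0 ≤ (k + 1) / δ)
      rw [← mul_assoc, div_mul_cancel₀ _ hδ0.ne'] at h1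
      rw [hh', add_mul]
      linarith
  have hmain : ∀ n : ℕ, fourierNorm ω h (z n) ≤
      ENNReal.ofReal (C * Real.exp (-(b / 2) * n)) * I +
        ENNReal.ofReal (Real.exp (-(k + 1) * n)) * fourierNorm ω h' (z n) := by
    intro n
    have hm := measurable_enorm_fourier_mul_weight ω h' (hz n)
    have hm' : Measurable fun ξ : Space d => ENNReal.ofReal (Real.exp (-ω ‖ξ‖)) := by
      simpa using measurable_weight (d := d) ω (-1)
    rw [hI, fourierNorm, fourierNorm, ← lintegral_const_mul _ hm, ← lintegral_const_mul _ hm',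
      ← lintegral_add_left (hm'.const_mul _)]
    refine lintegral_mono fun ξ => ?_
    simp only [← ofReal_norm]
    rw [← ENNReal.ofReal_mul (norm_nonneg _), ← ENNReal.ofReal_mul (norm_nonneg _),
      ← ENNReal.ofReal_mul (by positivity), ← ENNReal.ofReal_mul (by positivity),
      ← ENNReal.ofReal_add (by positivity) (by positivity)]
    exact ENNReal.ofReal_le_ofReal (hpt n ξ)
  have hgeom : ∀ a : ℝ, 0 < a → Summable fun n : ℕ => Real.exp (-a * n) := fun a ha => by
    simpa [mul_comm] using Real.summable_exp_nat_mul_iff.2 (neg_lt_zero.2 ha)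
  have hS : Summable fun n : ℕ =>
      C * I.toReal * Real.exp (-(b / 2) * n) + |A| * Real.exp (-1 * n) :=
    ((hgeom _ (half_pos hb)).mul_left _).add ((hgeom 1 one_pos).mul_left _)
  -- The growth bound holds only for large n. The finitely many remaining terms are finite by
  -- `hfin`, so the summation is done in ℝ.
  have hS' : Summable fun n => (fourierNorm ω h (z n)).toReal := by
    refine hS.of_norm_bounded_eventually_nat ?_
    filter_upwards [hA] with n hn
    rw [Real.norm_of_nonneg ENNReal.toReal_nonneg]
    refine ENNReal.toReal_le_of_le_ofReal (by positivity) ((hmain n).trans ?_)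
    rw [ENNReal.ofReal_add (by positivity) (by positivity)]
    refine add_le_add (le_of_eq ?_) ?_
    · rw [mul_right_comm, ENNReal.ofReal_mul (p := C * _) (by positivity),
        ENNReal.ofReal_toReal hI']
    · refine (mul_le_mul_right hn _).trans ?_
      rw [← ENNReal.ofReal_mul (Real.exp_pos _).le]
      refine ENNReal.ofReal_le_ofReal ?_
      calc Real.exp (-(k + 1) * n) * (A * Real.exp (k * n))
          = A * Real.exp (-1 * n) := by
            rw [mul_left_comm, ← Real.exp_add]
            ring_nf
        _ ≤ _ := by
            gcongr
            exact le_abs_self A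
  have := hS'.tsum_ofReal_ne_top
  simpa only [ENNReal.ofReal_toReal (hfin h hh _).ne] using this

/-- A sequence of test functions with supports in a fixed compact set whose increments are
absolutely summable for all the norms `‖·‖_l^ω` converges to a test function. -/
theorem exists_tendsto_testFunctions {K : Set (Space d)} (hK : IsCompact K) (hKΩ : K ⊆ Ω)
    {z : ℕ → Space d → ℂ} (hz : ∀ n, z n ∈ testFunctions ω Ω) (hzK : ∀ n, ∀ x ∉ K, z n x = 0)
    (hsum : ∀ l : ℝ, 0 < l → ∑' n, fourierNorm ω l (z (n + 1) - z n) ≠ ∞) :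
    ∃ Z ∈ testFunctions ω Ω, (∀ x, Tendsto (fun n => z n x) atTop (𝓝 (Z x))) ∧
      Tendsto (fun n => ∫ x, z n x) atTop (𝓝 (∫ x, Z x)) := by
  -- Telescoping series with z 0 in front, so that the sum of the first n + 1 terms is z n.
  let w : ℕ → Space d → ℂ := fun n => Nat.casesOn n (z 0) fun m => z (m + 1) - z m
  have hw : ∀ n, w n ∈ testFunctions ω Ω := by
    rintro (_ | n)
    · exact hz 0
    · exact sub_mem (hz (n + 1)) (hz n)
  have hwK : ∀ n, ∀ x ∉ K, w n x = 0 := by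
    rintro (_ | n) x hx
    · exact hzK 0 x hx
    · simp [w, hzK _ x hx]
  have hwsum : ∀ l : ℝ, 0 < l → ∑' n, fourierNorm ω l (w n) ≠ ∞ := fun l hl => by
    rw [tsum_eq_zero_add' ENNReal.summable]
    exact ENNReal.add_ne_top.2 ⟨((hz 0).2.2.2 l hl).ne, hsum l hl⟩
  have hpart : ∀ n x, ∑ i ∈ Finset.range (n + 1), w i x = z n x := fun n x => by
    rw [Finset.sum_range_succ']
    simp only [w, Pi.sub_apply]
    rw [Finset.sum_range_sub (fun i => z i x)]
    exact sub_add_cancel _ _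
  have hb := ENNReal.summable_toReal (hwsum 1 one_pos)
  have hwb := fun n => norm_apply_le_fourierNorm (hw n)
  refine ⟨_, tsum_mem_testFunctions hK hKΩ hw hwK hwsum, fun x => ?_, ?_⟩
  · have h := (Summable.of_norm_bounded hb fun n => hwb n x).hasSum.tendsto_sum_nat
    simpa only [Function.comp_def, hpart] using h.comp (tendsto_add_atTop_nat 1)
  · have h := (hasSum_integral_mul hK (fun n => (hw n).1.continuous) hwK hb hwb
      (continuousOn_const (c := (1 : ℂ)))).tendsto_sum_nat.comp (tendsto_add_atTop_nat 1)
    simp only [one_mul, Function.comp_def] at h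
    simpa only [← integral_finsetSum _ fun i _ => integrable_of_mem_testFunctions (hw i), hpart]
      using h

end Regularity

/-! ### Strong association and the limit of a regular net -/

section Association

variable {ω : WeightFunction} {Ω : TopologicalSpace.Opens (Space d)}

theorem norm_integral_mul_le {u ψ : Space d → ℂ} (hu : u ∈ ultradiffFunctions ω Ω)
    (hψ : ψ ∈ testFunctions ω Ω) :
    ‖∫ x, u x * ψ x‖ ≤ (fourierNorm ω 1 (ψ * u)).toReal * volume.real (tsupport ψ) := by
  simp only [mul_comm (u _)]
  refine (norm_integral_le_integral_norm _).trans
    (integral_norm_le_of_forall_notMem hψ.2.1 (fun x hx => ?_) fun x _ =>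
      norm_apply_le_fourierNorm (hu.2 ψ hψ) x)
  simp [image_eq_zero_of_notMem_tsupport hx]

theorem NormLittleO.eventually_fourierNorm_mul_le {g : Net ω Ω} (ψ : testFunctions ω Ω) {h k : ℝ}
    (hh : 0 < h) (hg : NormLittleO g (tsupport (ψ : Space d → ℂ)) h k) :
    ∀ᶠ ε in epsFilter, fourierNorm ω h ((ψ : Space d → ℂ) * (g ε : Space d → ℂ)) ≤
      ENNReal.ofReal (((fourierNorm ω h (ψ : Space d → ℂ)).toReal + 1) *
        Real.exp (k * ω (1 / (ε : ℝ)))) := by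
  filter_upwards [hg.eventually_lt_const zero_lt_one] with ε hε
  refine (fourierNorm_mul_le_localNorm ψ (g ε).2 hh).trans ?_
  rw [ENNReal.ofReal_mul (by positivity), ENNReal.ofReal_add ENNReal.toReal_nonneg zero_le_one,
    ENNReal.ofReal_toReal (ψ.2.2.2.2 h hh).ne, ENNReal.ofReal_one]
  gcongr
  have h1 := (ENNReal.div_le_iff (ENNReal.ofReal_pos.2 (Real.exp_pos _)).ne'
    ENNReal.ofReal_ne_top).1 hε.le
  rwa [one_mul] at h1

/-- Allows a change of representative: strong association and regularity may be witnessed by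
different nets of the same class. -/
theorem IsNegligible.isBigO_integral {g : Net ω Ω} (hg : IsNegligible g) (ψ : testFunctions ω Ω)
    {b : ℝ} (hb : 0 < b) :
    (fun ε => ∫ x, (g ε : Space d → ℂ) x * (ψ : Space d → ℂ) x)
      =O[epsFilter] fun ε => Real.exp (-b * ω (1 / (ε : ℝ))) := by
  refine Asymptotics.IsBigO.of_bound (((fourierNorm ω 1 (ψ : Space d → ℂ)).toReal + 1) *
    volume.real (tsupport (ψ : Space d → ℂ))) ?_
  filter_upwards [(hg _ ψ.2.2.1 ψ.2.2.2.1 1 one_pos b hb).eventually_fourierNorm_mul_le ψ one_pos]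
    with ε hε
  refine (norm_integral_mul_le (g ε).2 ψ.2).trans ?_
  rw [mul_right_comm, Real.norm_of_nonneg (Real.exp_pos _).le]
  gcongr
  exact ENNReal.toReal_le_of_le_ofReal (by positivity) hε

/-- Strong association can be tested on any representative, up to replacing `o` by `O`. -/
theorem StronglyAssociated.isBigO {T : Ultradistribution ω Ω} {g : Net ω Ω} {hg : IsModerate g}
    (hT : StronglyAssociated T (Generalized.mk g hg)) {K : Set (Space d)} (hK : IsCompact K)
    (hKΩ : K ⊆ Ω) : ∃ b : ℝ, 0 < b ∧
      ∀ φ : testFunctions ω Ω, tsupport (φ : Space d → ℂ) ⊆ K →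
        (fun ε => (∫ x, (g ε : Space d → ℂ) x * (φ : Space d → ℂ) x) - T.toLinearMap φ)
          =O[epsFilter] fun ε => Real.exp (-b * ω (1 / (ε : ℝ))) := by
  obtain ⟨g', hg', heq, hass⟩ := hT
  have hneg : IsNegligible (g' - g) := Quotient.exact heq
  obtain ⟨b, hb, hbφ⟩ := hass K hK hKΩ
  refine ⟨b, hb, fun φ hφ => ?_⟩
  refine ((hbφ φ hφ).isBigO.sub (hneg.isBigO_integral φ hb)).congr_left fun ε => ?_
  have hint : ∀ u ∈ ultradiffFunctions ω Ω,
      Integrable fun x => u x * (φ : Space d → ℂ) x := fun u hu => by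
    simpa only [mul_comm (u _)] using! integrable_of_mem_testFunctions (hu.2 φ φ.2)
  have h1 : ∫ x, ((g' - g) ε : Space d → ℂ) x * (φ : Space d → ℂ) x =
      (∫ x, (g' ε : Space d → ℂ) x * (φ : Space d → ℂ) x) -
        ∫ x, (g ε : Space d → ℂ) x * (φ : Space d → ℂ) x := by
    rw [← integral_sub (hint _ (g' ε).2) (hint _ (g ε).2)]
    congr 1 with x
    exact sub_mul _ _ _
  rw [h1]
  ring

/-- Along a suitable sequence of parameters, a regular net to which an ultradistribution is
strongly associated converges in `ℰ^{(ω)}(Ω)`. -/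
theorem exists_tendsto_mul_of_isRegularNet {T : Ultradistribution ω Ω} {g : Net ω Ω}
    (hg : IsRegularNet g) (hT : StronglyAssociated T (Generalized.mk g hg.1)) {c : ℝ}
    {e : ℕ → Set.Ioo (0 : ℝ) 1} (he : Tendsto e atTop epsFilter)
    (hω : ∀ n : ℕ, ω (1 / (e n : ℝ)) = n + c) (φ : testFunctions ω Ω) :
    ∃ Z ∈ testFunctions ω Ω,
      (∀ x, Tendsto (fun n => (φ : Space d → ℂ) x * (g (e n) : Space d → ℂ) x) atTop (𝓝 (Z x))) ∧
      T.toLinearMap φ = ∫ x, Z x := by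
  obtain ⟨b, hb, hbφ⟩ := hT.isBigO φ.2.2.1 φ.2.2.2.1
  obtain ⟨k, hk, hreg⟩ := hg.2 _ φ.2.2.1 φ.2.2.2.1
  set v : ℕ → Space d → ℂ := fun n => (g (e n) : Space d → ℂ) with hv
  have hvmem : ∀ n, v n ∈ ultradiffFunctions ω Ω := fun n => (g (e n)).2
  have hφv : ∀ n, (φ : Space d → ℂ) * v n ∈ testFunctions ω Ω := fun n => (hvmem n).2 φ φ.2
  have hexp : (fun n : ℕ => Real.exp (-b * ω (1 / (e n : ℝ)))) =O[atTop]
      fun n : ℕ => Real.exp (-b * n) := by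
    refine Asymptotics.IsBigO.of_bound (Real.exp (-b * c)) (Eventually.of_forall fun n => ?_)
    rw [hω, mul_add, Real.exp_add, norm_mul, mul_comm, Real.norm_of_nonneg (Real.exp_pos (-b * c)).le]
  have hO : ∀ ψ : testFunctions ω Ω, tsupport (ψ : Space d → ℂ) ⊆ tsupport (φ : Space d → ℂ) →
      (fun n => (∫ x, v n x * (ψ : Space d → ℂ) x) - T.toLinearMap ψ) =O[atTop]
        fun n : ℕ => Real.exp (-b * n) := fun ψ hψ =>
    ((hbφ ψ hψ).comp_tendsto he).trans hexp
  have hint : ∀ n, ∀ ψ ∈ testFunctions ω Ω, Integrable fun x => v n x * ψ x := fun n ψ hψ => by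
    simpa only [mul_comm (v n _)] using! integrable_of_mem_testFunctions ((hvmem n).2 ψ hψ)
  have hshift : (fun n : ℕ => Real.exp (-b * (n + 1 : ℕ))) =O[atTop]
      fun n : ℕ => Real.exp (-b * n) := by
    refine Asymptotics.IsBigO.of_bound 1 (Eventually.of_forall fun n => ?_)
    rw [one_mul, Real.norm_of_nonneg (Real.exp_pos _).le, Real.norm_of_nonneg (Real.exp_pos _).le]
    push_cast
    exact Real.exp_le_exp.2 (by linarith)
  obtain ⟨C, l, -, hl, hdecay⟩ := exists_fourier_mul_bound (b := b)
    (u := fun n => v (n + 1) - v n) (fun n => sub_mem (hvmem _) (hvmem _)) φ.2 fun ψ hψ hψφ => by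
      have h1 := (((hO ⟨ψ, hψ⟩ hψφ).comp_tendsto (tendsto_add_atTop_nat 1)).trans hshift).sub
        (hO ⟨ψ, hψ⟩ hψφ)
      -- The comparison function never vanishes, so enlarging the constant gives the bound for all
      -- n.
      obtain ⟨M, -, hM⟩ := Asymptotics.bound_of_isBigO_nat_atTop h1
      refine ⟨M, fun n => ?_⟩
      have h2 := hM (x := n) (Real.exp_pos _).ne'
      rw [Real.norm_of_nonneg (Real.exp_pos _).le] at h2
      refine le_of_eq_of_le (congrArg norm ?_) h2
      simp only [Function.comp_apply, sub_sub_sub_cancel_right, Pi.sub_apply, sub_mul]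
      exact integral_sub (hint _ ψ hψ) (hint _ ψ hψ)
  have hgrow : ∀ h : ℝ, 0 < h → ∃ A : ℝ, ∀ᶠ n : ℕ in atTop,
      fourierNorm ω h ((φ : Space d → ℂ) * (v (n + 1) - v n)) ≤
        ENNReal.ofReal (A * Real.exp (k * n)) := by
    intro h hh
    set B := (fourierNorm ω h (φ : Space d → ℂ)).toReal + 1 with hB
    have hB0 : 0 < B := by positivity
    have h1 := he.eventually ((hreg h hh).eventually_fourierNorm_mul_le φ hh)
    -- The two terms come from the indices n + 1 and n; only this constant depends on h, not the
    -- rate k.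
    refine ⟨B * Real.exp (k * (1 + c)) + B * Real.exp (k * c), ?_⟩
    filter_upwards [h1, (tendsto_add_atTop_nat 1).eventually h1] with n hn hn'
    have h2 : (φ : Space d → ℂ) * (v (n + 1) - v n) =
        (φ : Space d → ℂ) * v (n + 1) + (-1 : ℂ) • ((φ : Space d → ℂ) * v n) := by
      rw [mul_sub, neg_one_smul, sub_eq_add_neg]
    rw [h2]
    refine (fourierNorm_add_le ω h (integrable_of_mem_testFunctions (hφv _))
      ((integrable_of_mem_testFunctions (hφv _)).smul _)).trans ?_
    rw [fourierNorm_smul, enorm_neg, enorm_one, one_mul]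
    refine (add_le_add hn' hn).trans (le_of_eq ?_)
    rw [← ENNReal.ofReal_add (by positivity) (by positivity), hω, hω]
    congr 1
    push_cast
    simp only [mul_add, Real.exp_add]
    ring
  have hz0 : ∀ n, ∀ x ∉ tsupport (φ : Space d → ℂ), ((φ : Space d → ℂ) * v n) x = 0 :=
    fun n x hx => by simp [image_eq_zero_of_notMem_tsupport hx]
  have hdiff : ∀ n, (φ : Space d → ℂ) * (v (n + 1) - v n) ∈ testFunctions ω Ω := fun n =>
    (sub_mem (hvmem (n + 1)) (hvmem n)).2 φ φ.2
  obtain ⟨Z, hZ, hlim, hZint⟩ := exists_tendsto_testFunctions φ.2.2.1 φ.2.2.2.1 hφv hz0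
    fun h hh => by
      simp only [← mul_sub]
      exact tsum_fourierNorm_ne_top (fun n => integrable_of_mem_testFunctions (hdiff n)) hb hl.le
        hdecay (fun h hh n => (hdiff n).2.2.2 h hh) hk hgrow hh
  refine ⟨Z, hZ, hlim, tendsto_nhds_unique ?_ hZint⟩
  have hexp0 : Tendsto (fun n : ℕ => Real.exp (-b * n)) atTop (𝓝 0) :=
    Real.tendsto_exp_atBot.comp
      (tendsto_natCast_atTop_atTop.const_mul_atTop_of_neg (neg_lt_zero.2 hb))
  have h1 := ((hO φ subset_rfl).trans_tendsto hexp0).add_const (T.toLinearMap φ)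
  simp only [sub_add_cancel, zero_add] at h1
  exact h1.congr fun n => by simp only [Pi.mul_apply, mul_comm]

theorem StronglyAssociated.isUltradifferentiable {T : Ultradistribution ω Ω}
    {g : Generalized ω Ω} (hT : StronglyAssociated T g) (hg : g ∈ Generalized.regular ω Ω) :
    T.IsUltradifferentiable := by
  obtain ⟨u, _, rfl, hu⟩ := hg
  obtain ⟨e, c, he, hω⟩ := exists_seq_weight_eq ω
  choose Z hZ hlim hTZ using exists_tendsto_mul_of_isRegularNet hu hT he hω
  -- The sequence `e` does not depend on φ, so one f serves all test functions. Where every test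
  -- function vanishes, `limUnder` may be a default value, which is harmless.
  set f : Space d → ℂ := fun x => limUnder atTop fun n => (u (e n) : Space d → ℂ) x with hf
  have hZf : ∀ φ : testFunctions ω Ω, (φ : Space d → ℂ) * f = Z φ := by
    intro φ
    ext x
    by_cases hx : (φ : Space d → ℂ) x = 0
    · have h0 := hlim φ x
      simp only [hx, zero_mul] at h0
      rw [Pi.mul_apply, hx, zero_mul]
      exact tendsto_nhds_unique tendsto_const_nhds h0
    · have h1 := (hlim φ x).const_mul ((φ : Space d → ℂ) x)⁻¹
      simp only [inv_mul_cancel_left₀ hx] at h1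
      rw [Pi.mul_apply, hf]
      simp only [h1.limUnder_eq]
      exact mul_inv_cancel_left₀ hx _
  refine ⟨f, ⟨fun x hx => ?_, fun φ hφ => ?_⟩, fun φ => ?_⟩
  · obtain ⟨K, hK, hxK, hKΩ⟩ := exists_compact_subset Ω.isOpen hx
    -- Moderateness of the net provides a cutoff; near x the function f coincides with the test
    -- function Z χ.
    obtain ⟨χ, hχ⟩ := hu.1.exists_cutoff hK hKΩ
    refine ContDiffAt.contDiffWithinAt ((hZ χ).1.contDiffAt.congr_of_eventuallyEq ?_)
    filter_upwards [mem_interior_iff_mem_nhds.1 hxK] with y hy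
    rw [← hZf χ, Pi.mul_apply, hχ y hy, one_mul]
  · rw [hZf ⟨φ, hφ⟩]
    exact hZ _
  · rw [hTZ, ← hZf φ]
    simp only [Pi.mul_apply, mul_comm]

end Association

end BeurlingBjorck

end

theorem mainTheorem1 (d : ℕ) (ω : BeurlingBjorck.WeightFunction)
    (Ω : TopologicalSpace.Opens (BeurlingBjorck.Space d))
    (T : BeurlingBjorck.Ultradistribution ω Ω) (g : BeurlingBjorck.Generalized ω Ω)
    (hg : g ∈ BeurlingBjorck.Generalized.regular ω Ω)
    (hT : BeurlingBjorck.StronglyAssociated T g) :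
    T.IsUltradifferentiable :=
  hT.isUltradifferentiable hg
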